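/- All digraphs are finite, have at least one vertex, and have neither loops nor multiple arcs (arcs in both directions between two vertices are allowed). For digraphs $G_1,\dots,G_k$ ($k\ge 1$) with pairwise disjoint vertex sets, the disjoint union $G_1\oplus\dots\oplus G_k$ has as vertices and arcs those of all the $G_i$; the order composition $G_1\oslash\dots\oslash G_k$ has in addition all arcs from vertices of $G_i$ to vertices of $G_j$ for $i<j$. The class of oriented co-graphs is the smallest class of digraphs containing all one-vertex digraphs and closed under $\oplus$ and $\oslash$. (Undirected) co-graphs are the graphs generated from single vertices by disjoint union and join. Let - $D_1=(\{a,b,c\},\{(a,b),(b,c)\})$, - $D_5=(\{a,b,c\},\{(a,b),(b,c),(c,a)\})$, - $D_8=(\{a,b,c,d\},\{(a,b),(c,b),(c,d)\})$, - $\overleftrightarrow{P_2}=(\{a,b\},\{(a,b),(b,a)\})$ (the bidirected edge), and let $\mathrm{Free}(F)$ be the class of all digraphs (graphs) no induced subdigraph (subgraph) of which is isomorphic to a member of $F$. Let $P_4$ be the undirected path on four vertices. Let $\mathrm{un}(G)$ be the underlying undirected graph of $G$. A digraph $G=(V,A)$ is transitive if $(u,v),(v,w)\in A$ and $u\ne w$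 imply $(u,w)\in A$. The directed NLC-width of $G$ is the least $k$ such that, for some labelling of its vertices by $[k]=\{1,\dots,k\}$, $G$ can be built from single labelled vertices using: (i) for relations $S,T\subseteq[k]^2$, the disjoint union of two labelled digraphs $H$ and $J$ together with all arcs $(u,v)$ with $u\in H$, $v\in J$, $(\mathrm{lab}(u),\mathrm{lab}(v))\in S$ and all arcs $(v,u)$ with $u\in H$, $v\in J$, $(\mathrm{lab}(u),\mathrm{lab}(v))\in T$; (ii) relabelling by a map $[k]\to[k]$. The directed clique-width of $G$ is the least $k$ such that, for some labelling of its vertices by $[k]$, $G$ can be built from single labelled vertices using disjoint union, changing all labels $a$ into $b$, and inserting all arcs from vertices labelled $a$ to vertices labelled $b$ for labels $a\neq b$. **Theorem.** For every digraph $G$ the following are equivalent: 1. $G$ is an oriented co-graph; 2. $G\in\mathrm{Free}(\{D_1,D_5,D_8,\overleftrightarrow{P_2}\})$; 3. $G\in\mathrm{Free}(\{D_1,D_5,\overleftrightarrow{P_2}\})$ and $\mathrm{un}(G)\in\mathrm{Free}(\{P_4\})$; 4. $G\in\mathrm{Free}(\{D_1,D_5,\overleftrightarrow{P_2}\})$ and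 $\mathrm{un}(G)$ is a co-graph; 5. $G$ has directed NLC-width $1$ and $G\in\mathrm{Free}(\{\overleftrightarrow{P_2}\})$; 6. $G$ has directed clique-width at most $2$ and $G\in\mathrm{Free}(\{\overleftrightarrow{P_2}\})$; 7. $G$ is transitive and $G\in\mathrm{Free}(\{\overleftrightarrow{P_2},D_8\})$. -/

import Mathlib

universe u

namespace OrientedCograph

/-! ### Forbidden induced subdigraphs -/

/-- `Free F G`: no induced subdigraph of `G` is isomorphic to a member of `F`. Members of `F` are
finite digraphs, given on the vertex sets `Fin n`. -/
def Free {V : Type u} (F : Set (Σ n : ℕ, Digraph (Fin n))) (G : Digraph V) : Prop :=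
  ∀ H ∈ F, ∀ S : Set V, IsEmpty (H.2.Adj ≃r fun x y : S => G.Adj x y)

/-- The digraph on `Fin n` whose arcs are the members of the given set of pairs. -/
def ofArcs (n : ℕ) (A : Set (Fin n × Fin n)) : Σ n : ℕ, Digraph (Fin n) :=
  ⟨n, { Adj := fun u v => (u, v) ∈ A }⟩

/-- `D₁`: the oriented path on three vertices. -/
def D₁ : Σ n : ℕ, Digraph (Fin n) := ofArcs 3 {(0, 1), (1, 2)}

/-- `D₅`: the oriented cycle on three vertices. -/
def D₅ : Σ n : ℕ, Digraph (Fin n) := ofArcs 3 {(0, 1), (1, 2), (2, 0)}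

/-- `D₈`: the orientation `0 → 1 ← 2 → 3` of the path on four vertices with alternating arcs. -/
def D₈ : Σ n : ℕ, Digraph (Fin n) := ofArcs 4 {(0, 1), (2, 1), (2, 3)}

/-- The bidirected edge: the complete biorientation of the path on two vertices. -/
def biP₂ : Σ n : ℕ, Digraph (Fin n) := ofArcs 2 {(0, 1), (1, 0)}

/-- The underlying undirected graph: `u ≠ v` are adjacent when `(u, v)` or `(v, u)` is an arc. -/
def un {V : Type u} (G : Digraph V) : SimpleGraph V := G.toSimpleGraphInclusive

/-- Transitivity of a digraph, where closed walks of length two are disregarded. -/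
def IsTransitive {V : Type u} (G : Digraph V) : Prop :=
  ∀ x y z : V, G.Adj x y → G.Adj y z → x ≠ z → G.Adj x z

/-! ### Oriented co-graphs and undirected co-graphs -/

/-- Disjoint union of `k` digraphs, on the disjoint union of the vertex sets. -/
def disjointUnion {k : ℕ} {V : Fin k → Type u} (G : ∀ i, Digraph (V i)) : Digraph (Σ i, V i) where
  Adj p q := ∃ (i : Fin k) (a b : V i), p = ⟨i, a⟩ ∧ q = ⟨i, b⟩ ∧ (G i).Adj a b

/-- Order composition of `k` digraphs: their disjoint union plus all arcs from the `i`-th to the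
`j`-th vertex set for `i < j`. -/
def orderComp {k : ℕ} {V : Fin k → Type u} (G : ∀ i, Digraph (V i)) : Digraph (Σ i, V i) where
  Adj p q := (disjointUnion G).Adj p q ∨ p.1 < q.1

/-- Oriented co-graphs: generated from single vertices without arcs by disjoint unions and order
compositions of `k ≥ 1` digraphs. The vertex-disjoint union of vertex sets is a sum type,
so closure under isomorphism is part of the definition. -/
inductive IsOrientedCograph : {V : Type u} → Digraph V → Prop
  | single {V : Type u} [Unique V] : IsOrientedCograph (⊥ : Digraph V)
  | disjointUnion {k : ℕ} (hk : 1 ≤ k) {V : Fin k → Type u} (G : ∀ i, Digraph (V i))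
      (hG : ∀ i, IsOrientedCograph (G i)) : IsOrientedCograph (disjointUnion G)
  | orderComp {k : ℕ} (hk : 1 ≤ k) {V : Fin k → Type u} (G : ∀ i, Digraph (V i))
      (hG : ∀ i, IsOrientedCograph (G i)) : IsOrientedCograph (orderComp G)
  | iso {V W : Type u} {G : Digraph V} {H : Digraph W} (e : G.Adj ≃r H.Adj)
      (hG : IsOrientedCograph G) : IsOrientedCograph H

/-- Disjoint union of `k` undirected graphs. -/
def graphUnion {k : ℕ} {V : Fin k → Type u} (G : ∀ i, SimpleGraph (V i)) :
    SimpleGraph (Σ i, V i) where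
  Adj p q := ∃ (i : Fin k) (a b : V i), p = ⟨i, a⟩ ∧ q = ⟨i, b⟩ ∧ (G i).Adj a b
  symm := ⟨fun _ _ ⟨i, a, b, hp, hq, h⟩ => ⟨i, b, a, hq, hp, h.symm⟩⟩
  loopless := ⟨by
    rintro p ⟨i, a, b, rfl, hq, h⟩
    cases hq
    exact (G i).loopless.irrefl _ h⟩

/-- Join composition of `k` undirected graphs: their disjoint union plus all edges between
different parts. -/
def graphJoin {k : ℕ} {V : Fin k → Type u} (G : ∀ i, SimpleGraph (V i)) :
    SimpleGraph (Σ i, V i) where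
  Adj p q := (graphUnion G).Adj p q ∨ p.1 ≠ q.1
  symm := ⟨fun _ _ h => h.imp (fun h => h.symm) Ne.symm⟩
  loopless := ⟨fun p h => h.elim ((graphUnion G).loopless.irrefl p) fun h => h rfl⟩

/-- Undirected co-graphs: generated from single vertices by disjoint unions and joins. -/
inductive IsCograph : {V : Type u} → SimpleGraph V → Prop
  | single {V : Type u} [Unique V] : IsCograph (⊥ : SimpleGraph V)
  | graphUnion {k : ℕ} (hk : 1 ≤ k) {V : Fin k → Type u} (G : ∀ i, SimpleGraph (V i))
      (hG : ∀ i, IsCograph (G i)) : IsCograph (graphUnion G)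
  | graphJoin {k : ℕ} (hk : 1 ≤ k) {V : Fin k → Type u} (G : ∀ i, SimpleGraph (V i))
      (hG : ∀ i, IsCograph (G i)) : IsCograph (graphJoin G)
  | iso {V W : Type u} {G : SimpleGraph V} {H : SimpleGraph W} (e : G ≃g H)
      (hG : IsCograph G) : IsCograph H

/-! ### Directed NLC-width and directed clique-width -/

/-- The NLC composition of two labelled digraphs: their disjoint union plus an arc `(u, v)` for
every `u` in `G`, `v` in `H` with `(lab u, lab v) ∈ S`, and an arc `(v, u)` for every `u` in `G`,
`v` in `H` with `(lab u, lab v) ∈ T`. -/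
def nlcComp {k : ℕ} {V W : Type u} (G : Digraph V) (labG : V → Fin k) (H : Digraph W)
    (labH : W → Fin k) (S T : Set (Fin k × Fin k)) : Digraph (V ⊕ W) where
  Adj
    | .inl u, .inl v => G.Adj u v
    | .inr u, .inr v => H.Adj u v
    | .inl u, .inr v => (labG u, labH v) ∈ S
    | .inr v, .inl u => (labG u, labH v) ∈ T

/-- `DNLC k G lab`: the digraph `G` with labels `lab` in a set of `k` labels can be built from
single labelled vertices by the NLC composition and by relabelling along maps of the label set. -/
inductive DNLC (k : ℕ) : {V : Type u} → Digraph V → (V → Fin k) → Prop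
  | single {V : Type u} [Unique V] (a : Fin k) : DNLC k (⊥ : Digraph V) (fun _ => a)
  | comp {V W : Type u} {G : Digraph V} {labG : V → Fin k} {H : Digraph W} {labH : W → Fin k}
      (hG : DNLC k G labG) (hH : DNLC k H labH) (S T : Set (Fin k × Fin k)) :
      DNLC k (nlcComp G labG H labH S T) (Sum.elim labG labH)
  | relabel {V : Type u} {G : Digraph V} {lab : V → Fin k} (hG : DNLC k G lab)
      (R : Fin k → Fin k) : DNLC k G (fun v => R (lab v))
  | iso {V W : Type u} {G : Digraph V} {lab : V → Fin k} {H : Digraph W} (e : G.Adj ≃r H.Adj)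
      (hG : DNLC k G lab) : DNLC k H (fun w => lab (e.symm w))

/-- Directed NLC-width: the least `k` such that some labelling of `G` with `k` labels makes it
constructible (`⊤` if there is none). -/
noncomputable def dNLCWidth {V : Type u} (G : Digraph V) : ℕ∞ :=
  ⨅ (k : ℕ) (_ : ∃ lab : V → Fin k, DNLC k G lab), (k : ℕ∞)

/-- Disjoint union of two digraphs. -/
def sum {V W : Type u} (G : Digraph V) (H : Digraph W) : Digraph (V ⊕ W) where
  Adj := Sum.LiftRel G.Adj H.Adj

/-- Insertion of all arcs from vertices labelled `a` to vertices labelled `b`. -/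
def addArcs {k : ℕ} {V : Type u} (G : Digraph V) (lab : V → Fin k) (a b : Fin k) : Digraph V where
  Adj u v := G.Adj u v ∨ (lab u = a ∧ lab v = b)

/-- `DCW k G lab`: the digraph `G` with labels `lab` in a set of `k` labels can be built from
single labelled vertices by disjoint union, changing all labels `a` into `b`, and inserting all
arcs from label `a` to a different label `b`. -/
inductive DCW (k : ℕ) : {V : Type u} → Digraph V → (V → Fin k) → Prop
  | single {V : Type u} [Unique V] (a : Fin k) : DCW k (⊥ : Digraph V) (fun _ => a)
  | union {V W : Type u} {G : Digraph V} {labG : V → Fin k} {H : Digraph W} {labH : W → Fin k}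
      (hG : DCW k G labG) (hH : DCW k H labH) : DCW k (sum G H) (Sum.elim labG labH)
  | relabel {V : Type u} {G : Digraph V} {lab : V → Fin k} (hG : DCW k G lab) (a b : Fin k) :
      DCW k G (fun v => if lab v = a then b else lab v)
  | addArcs {V : Type u} {G : Digraph V} {lab : V → Fin k} (hG : DCW k G lab) {a b : Fin k}
      (hab : a ≠ b) : DCW k (addArcs G lab a b) lab
  | iso {V W : Type u} {G : Digraph V} {lab : V → Fin k} {H : Digraph W} (e : G.Adj ≃r H.Adj)
      (hG : DCW k G lab) : DCW k H (fun w => lab (e.symm w))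

/-- Directed clique-width: the least `k` such that some labelling of `G` with `k` labels makes it
constructible (`⊤` if there is none). -/
noncomputable def dCliqueWidth {V : Type u} (G : Digraph V) : ℕ∞ :=
  ⨅ (k : ℕ) (_ : ∃ lab : V → Fin k, DCW k G lab), (k : ℕ∞)

end OrientedCograph

namespace OrientedCograph

/-! ### Embeddings and forbidden subdigraphs -/

/-! Each of the seven conditions is compared with a single one, `IsSeriesParallel`: the arcs form a
strict partial order with no induced N. Excluding `D₁`, `D₅` and `biP₂` from a loopless digraph
amounts to transitivity: a path a → b → c needs a and c joined, and the closing arc c → a is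
forbidden. Excluding `D₈` from a strict order excludes the N.

Series-parallel orders survive every construction in question. Disjoint unions and order
compositions are covered by `IsSeriesParallel.of_fibers`. With one NLC label, or at most two
clique-width labels, any step that keeps the digraph free of bidirected edges is again a parallel or
an ordinal sum.

Conversely, `IsSeriesParallel.induction` takes a finite nonempty series-parallel order apart. Its
underlying graph has no induced `P₄`, so by `exists_split` the vertices fall into two parts with
either no edge or every edge between them. No edges means a parallel sum. If all edges are present,
the arcs between the parts may point both ways, and `exists_ordinal_split` finds another cut across
which they all point the same way. This one recursion yields the co-graph, NLC and clique-width
constructions. -/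

lemma free_iff_embedding {V : Type u} (F : Set (Σ n : ℕ, Digraph (Fin n))) (G : Digraph V) :
    Free F G ↔ ∀ H ∈ F, IsEmpty (H.2.Adj ↪r G.Adj) := by
  refine forall₂_congr fun H _ => ⟨fun h => ⟨fun e => ?_⟩, fun h S => ⟨fun e => ?_⟩⟩
  · refine (h (Set.range e)).false ⟨Equiv.ofInjective e e.injective, ?_⟩
    intro a b
    exact e.map_rel_iff
  · exact h.false ⟨e.toEquiv.toEmbedding.trans (Function.Embedding.subtype _), e.map_rel_iff⟩

lemma isEmpty_embedding_ofArcs_iff {V : Type u} {n : ℕ} {A : Set (Fin n × Fin n)}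
    {G : Digraph V} : IsEmpty ((ofArcs n A).2.Adj ↪r G.Adj) ↔
      ∀ f : Fin n → V, Function.Injective f → ¬ ∀ i j, G.Adj (f i) (f j) ↔ (i, j) ∈ A := by
  constructor
  · exact fun h f hf hA => h.false (RelEmbedding.mk ⟨f, hf⟩ (hA _ _))
  · exact fun h => ⟨fun e => h e e.injective fun i j => e.map_rel_iff⟩

lemma isEmpty_embedding_biP₂_iff {V : Type u} {G : Digraph V} (hloop : ∀ v, ¬ G.Adj v v) :
    IsEmpty (biP₂.2.Adj ↪r G.Adj) ↔ ∀ a b, G.Adj a b → ¬ G.Adj b a := by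
  rw [biP₂, isEmpty_embedding_ofArcs_iff]
  constructor
  · intro h a b hab hba
    have hne : a ≠ b := by rintro rfl; exact hloop _ hab
    refine h ![a, b] ?_ ?_
    · simp [Function.Injective, Fin.forall_fin_succ, hne, hne.symm]
    · simp [Fin.forall_fin_succ, hab, hba, hloop]
  · intro h f _ hf
    have := h (f 0) (f 1)
    simp [hf] at this

lemma isEmpty_embedding_D₁_iff {V : Type u} {G : Digraph V} (hloop : ∀ v, ¬ G.Adj v v)
    (hasymm : ∀ a b, G.Adj a b → ¬ G.Adj b a) :
    IsEmpty (D₁.2.Adj ↪r G.Adj) ↔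
      ∀ a b c, G.Adj a b → G.Adj b c → G.Adj a c ∨ G.Adj c a := by
  rw [D₁, isEmpty_embedding_ofArcs_iff]
  constructor
  · intro h a b c hab hbc
    by_contra! hac
    have h1 : a ≠ b := by rintro rfl; exact hloop _ hab
    have h2 : b ≠ c := by rintro rfl; exact hloop _ hbc
    have h3 : a ≠ c := by rintro rfl; exact hasymm _ _ hab hbc
    refine h ![a, b, c] ?_ ?_
    · simp [Function.Injective, Fin.forall_fin_succ, h1, h2, h3, h1.symm, h2.symm, h3.symm]
    · simp [Fin.forall_fin_succ, hab, hbc, hac, hloop, hasymm _ _ hab, hasymm _ _ hbc]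
  · intro h f _ hf
    have := h (f 0) (f 1) (f 2)
    simp [hf] at this

lemma isEmpty_embedding_D₅_iff {V : Type u} {G : Digraph V} (hloop : ∀ v, ¬ G.Adj v v)
    (hasymm : ∀ a b, G.Adj a b → ¬ G.Adj b a) :
    IsEmpty (D₅.2.Adj ↪r G.Adj) ↔ ∀ a b c, G.Adj a b → G.Adj b c → ¬ G.Adj c a := by
  rw [D₅, isEmpty_embedding_ofArcs_iff]
  constructor
  · intro h a b c hab hbc hca
    have h1 : a ≠ b := by rintro rfl; exact hloop _ hab
    have h2 : b ≠ c := by rintro rfl; exact hloop _ hbc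
    have h3 : a ≠ c := by rintro rfl; exact hloop _ hca
    refine h ![a, b, c] ?_ ?_
    · simp [Function.Injective, Fin.forall_fin_succ, h1, h2, h3, h1.symm, h2.symm, h3.symm]
    · simp [Fin.forall_fin_succ, hab, hbc, hca, hloop, hasymm _ _ hab, hasymm _ _ hbc, hasymm _ _ hca]
  · intro h f _ hf
    have := h (f 0) (f 1) (f 2)
    simp [hf] at this

/-- No distinctness is needed on the right: when two of the four vertices coincide, the arcs contain
a loop or already give one of the alternatives. -/
lemma isEmpty_embedding_D₈_iff {V : Type u} {G : Digraph V} (hloop : ∀ v, ¬ G.Adj v v)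
    (htrans : ∀ a b c, G.Adj a b → G.Adj b c → G.Adj a c) :
    IsEmpty (D₈.2.Adj ↪r G.Adj) ↔
      ∀ a b c d, G.Adj a b → G.Adj c b → G.Adj c d →
        G.Adj a d ∨ G.Adj a c ∨ G.Adj c a ∨ G.Adj b d ∨ G.Adj d b := by
  have hasymm : ∀ a b, G.Adj a b → ¬ G.Adj b a := fun a b h h' => hloop _ (htrans _ _ _ h h')
  rw [D₈, isEmpty_embedding_ofArcs_iff]
  constructor
  · intro h a b c d hab hcb hcd
    by_contra! hn
    obtain ⟨had, hac, hca, hbd, hdb⟩ := hn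
    -- The alternative d → a can be left off the list: with c → d it gives c → a.
    have hda : ¬ G.Adj d a := fun h => hca (htrans _ _ _ hcd h)
    have h1 : a ≠ b := by rintro rfl; exact hloop _ hab
    have h2 : a ≠ c := by rintro rfl; exact had hcd
    have h3 : a ≠ d := by rintro rfl; exact hca hcd
    have h4 : b ≠ c := by rintro rfl; exact hloop _ hcb
    have h5 : b ≠ d := by rintro rfl; exact had hab
    have h6 : c ≠ d := by rintro rfl; exact hloop _ hcd
    refine h ![a, b, c, d] ?_ ?_
    · simp [Function.Injective, Fin.forall_fin_succ, h1, h2, h3, h4, h5, h6, h1.symm, h2.symm, h3.symm, h4.symm, h5.symm, h6.symm]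
    · simp [Fin.forall_fin_succ, hab, hcb, hcd, had, hac, hca, hbd, hdb, hda, hloop,
          hasymm _ _ hab, hasymm _ _ hcb, hasymm _ _ hcd]
  · intro h f _ hf
    have := h (f 0) (f 1) (f 2) (f 3)
    simp [hf] at this

/-- A graph without induced path on four vertices, in first-order form. -/
def IsP₄Free {V : Type u} (G : SimpleGraph V) : Prop :=
  ∀ a b c d, G.Adj a b → G.Adj b c → G.Adj c d → G.Adj a c ∨ G.Adj b d ∨ G.Adj a d

lemma isP₄Free_iff {V : Type u} (G : SimpleGraph V) :
    IsP₄Free G ↔ ¬ (SimpleGraph.pathGraph 4).IsIndContained G := by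
  constructor
  · rintro h ⟨e⟩
    have := h (e 0) (e 1) (e 2) (e 3)
    simp [SimpleGraph.pathGraph_adj] at this
  · intro h a b c d hab hbc hcd
    by_contra! hn
    obtain ⟨hac, hbd, had⟩ := hn
    have h2 : a ≠ c := by rintro rfl; exact had hcd
    have h3 : a ≠ d := by rintro rfl; exact hac hcd.symm
    have h5 : b ≠ d := by rintro rfl; exact had hab
    have h1 := hab.ne
    have h4 := hbc.ne
    have h6 := hcd.ne
    have hf : ∀ i j, G.Adj (![a, b, c, d] i) (![a, b, c, d] j) ↔
        (SimpleGraph.pathGraph 4).Adj i j := by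
      simp [Fin.forall_fin_succ, SimpleGraph.pathGraph_adj, hab, hbc, hcd, hac, hbd, had,
        G.adj_comm d, G.adj_comm c, G.adj_comm b a]
    refine h ⟨RelEmbedding.mk ⟨![a, b, c, d], ?_⟩ (hf _ _)⟩
    simp [Function.Injective, Fin.forall_fin_succ, h1, h2, h3, h4, h5, h6, h1.symm, h2.symm, h3.symm, h4.symm, h5.symm, h6.symm]

/-! ### Series-parallel digraphs -/

/-- Strict partial orders without induced `N`, as digraphs. -/
structure IsSeriesParallel {V : Type u} (G : Digraph V) : Prop where
  irrefl : ∀ a, ¬ G.Adj a a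
  trans : ∀ a b c, G.Adj a b → G.Adj b c → G.Adj a c
  nFree : ∀ a b c d, G.Adj a b → G.Adj c b → G.Adj c d →
    G.Adj a d ∨ G.Adj a c ∨ G.Adj c a ∨ G.Adj b d ∨ G.Adj d b

lemma IsSeriesParallel.asymm {V : Type u} {G : Digraph V} (h : IsSeriesParallel G) (a b : V)
    (hab : G.Adj a b) : ¬ G.Adj b a := fun hba => h.irrefl _ (h.trans _ _ _ hab hba)

/-- The axioms are universal and mention no equality, so they pull back along any map, injective or
not. This handles induced subdigraphs and isomorphisms alike. -/
lemma IsSeriesParallel.of_comap {V : Type*} {W : Type*} {G : Digraph V} {H : Digraph W}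
    (hG : IsSeriesParallel G) (f : W → V) (hf : ∀ x y, H.Adj x y ↔ G.Adj (f x) (f y)) :
    IsSeriesParallel H := by
  constructor <;> simp only [hf]
  · exact fun a => hG.irrefl _
  · exact fun a b c => hG.trans _ _ _
  · exact fun a b c d => hG.nFree _ _ _ _

/-- The digraph induced on the fibre of `f` over `i`. -/
def fiberDigraph {V ι : Type*} (G : Digraph V) (f : V → ι) (i : ι) :
    Digraph {x // f x = i} where
  Adj x y := G.Adj x y

/-- The two alternatives are the parallel and the ordinal sum of the fibres. An N is connected, so a
parallel sum has it inside one fibre; its non-adjacent pairs also connect all four vertices, so the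
same holds for an ordinal sum. -/
lemma IsSeriesParallel.of_fibers {V ι : Type*} [LinearOrder ι] {G : Digraph V} (f : V → ι)
    (hf : ∀ i, IsSeriesParallel (fiberDigraph G f i))
    (h : (∀ x y, G.Adj x y → f x = f y) ∨
      (∀ x y, f x < f y → G.Adj x y) ∧ ∀ x y, G.Adj x y → f x ≤ f y) :
    IsSeriesParallel G := by
  have htr : ∀ a b c, f a = f b → f b = f c → G.Adj a b → G.Adj b c → G.Adj a c :=
    fun a b c e1 e2 => (hf (f c)).trans ⟨a, e1.trans e2⟩ ⟨b, e2⟩ ⟨c, rfl⟩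
  have hN : ∀ a b c d, f a = f d → f b = f d → f c = f d → G.Adj a b → G.Adj c b → G.Adj c d →
      G.Adj a d ∨ G.Adj a c ∨ G.Adj c a ∨ G.Adj b d ∨ G.Adj d b :=
    fun a b c d e1 e2 e3 => (hf (f d)).nFree ⟨a, e1⟩ ⟨b, e2⟩ ⟨c, e3⟩ ⟨d, rfl⟩
  refine ⟨fun a => (hf (f a)).irrefl ⟨a, rfl⟩, ?_, ?_⟩
  · rcases h with h | ⟨h1, h2⟩
    · exact fun a b c hab hbc => htr _ _ _ (h _ _ hab) (h _ _ hbc) hab hbc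
    · intro a b c hab hbc
      rcases (h2 _ _ hab).lt_or_eq with h | h
      · exact h1 _ _ (h.trans_le (h2 _ _ hbc))
      rcases (h2 _ _ hbc).lt_or_eq with h' | h'
      · exact h1 _ _ (h.trans_lt h')
      exact htr _ _ _ h h' hab hbc
  · rcases h with h | ⟨h1, h2⟩
    · intro a b c d hab hcb hcd
      have e1 := h _ _ hab
      have e2 := h _ _ hcb
      have e3 := h _ _ hcd
      exact hN _ _ _ _ (e1.trans (e2.symm.trans e3)) (e2.symm.trans e3) e3 hab hcb hcd
    · intro a b c d hab hcb hcd
      by_contra! hn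
      have e1 : ¬ f a < f c := fun h => hn.2.1 (h1 _ _ h)
      have e2 : ¬ f c < f a := fun h => hn.2.2.1 (h1 _ _ h)
      have e3 : ¬ f b < f d := fun h => hn.2.2.2.1 (h1 _ _ h)
      have e4 : ¬ f d < f b := fun h => hn.2.2.2.2 (h1 _ _ h)
      have e5 : ¬ f a < f d := fun h => hn.1 (h1 _ _ h)
      have e6 : f a = f c := le_antisymm (not_lt.1 e2) (not_lt.1 e1)
      have e7 : f b = f d := le_antisymm (not_lt.1 e4) (not_lt.1 e3)
      -- Since d → a is not among the excluded alternatives, this inequality comes from a → b and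
      -- the equality of the levels of b and d.
      have e8 : f a = f d := le_antisymm (e7 ▸ h2 _ _ hab) (not_lt.1 e5)
      have := hN a b c d e8 e7 (e6.symm.trans e8) hab hcb hcd
      tauto

/-! ### Splitting graphs without induced `P₄` -/

/-- If v is adjacent to all of X, it splits off; if it misses one side of the old cut, that side
stays separated. Otherwise v has neighbours on both sides, and its non-neighbours are separated from
the rest: an edge from a non-neighbour x to a neighbour y stays on one side, and x, y, v and a
neighbour of v on the other side would form an induced `P₄`. -/
lemma exists_split_insert {V : Type*} {R : V → V → Prop}
    (hsymm : ∀ a b, R a b → R b a)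
    (hP : ∀ a b c d, R a b → R b c → R c d → R a c ∨ R b d ∨ R a d)
    {X A : Set V} {v : V} (hv : v ∉ X) (hAX : A ⊆ X) (hA : A.Nonempty) (hB : (X \ A).Nonempty)
    (hcross : ∀ a ∈ A, ∀ b ∈ X \ A, ¬ R a b) :
    ∃ C ⊆ insert v X, C.Nonempty ∧ (insert v X \ C).Nonempty ∧
      ((∀ a ∈ C, ∀ b ∈ insert v X \ C, ¬ R a b) ∨ ∀ a ∈ C, ∀ b ∈ insert v X \ C, R a b) := by
  by_cases h0 : ∀ x ∈ X, R v x
  · refine ⟨{v}, by simp, by simp, ?_, Or.inr ?_⟩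
    · obtain ⟨b, hb⟩ := hB
      exact ⟨b, Or.inr hb.1, by rintro rfl; exact hv hb.1⟩
    · rintro a rfl b ⟨hb | hb, hb'⟩
      · exact absurd hb hb'
      · exact h0 b hb
  by_cases hA0 : ∀ a ∈ A, ¬ R v a
  · refine ⟨A, hAX.trans (Set.subset_insert _ _), hA, ⟨v, Or.inl rfl, fun h => hv (hAX h)⟩,
      Or.inl ?_⟩
    rintro a ha b ⟨rfl | hb, hb'⟩ hab
    · exact hA0 a ha (hsymm _ _ hab)
    · exact hcross a ha b ⟨hb, hb'⟩ hab
  by_cases hB0 : ∀ b ∈ X \ A, ¬ R v b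
  · refine ⟨X \ A, Set.sdiff_subset.trans (Set.subset_insert _ _), hB,
      ⟨v, Or.inl rfl, fun h => hv h.1⟩, Or.inl ?_⟩
    rintro a ha b ⟨rfl | hb, hb'⟩ hab
    · exact hB0 a ha (hsymm _ _ hab)
    · exact hcross b (by by_contra h; exact hb' ⟨hb, h⟩) a ha (hsymm _ _ hab)
  push Not at h0 hA0 hB0
  obtain ⟨x₀, hx₀, hvx₀⟩ := h0
  obtain ⟨a, ha, hva⟩ := hA0
  obtain ⟨b, hb, hvb⟩ := hB0
  refine ⟨{x ∈ X | ¬ R v x}, fun x hx => Or.inr hx.1, ⟨x₀, hx₀, hvx₀⟩,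
    ⟨v, Or.inl rfl, fun h => hv h.1⟩, Or.inl ?_⟩
  rintro x ⟨hx, hvx⟩ y ⟨rfl | hy, hy'⟩ hxy
  · exact hvx (hsymm _ _ hxy)
  have hvy : R v y := by by_contra h; exact hy' ⟨hy, h⟩
  have hxv : ¬ R x v := fun h => hvx (hsymm _ _ h)
  by_cases hxA : x ∈ A
  · have hyA : y ∈ A := by by_contra h; exact hcross x hxA y ⟨hy, h⟩ hxy
    rcases hP x y v b hxy (hsymm _ _ hvy) hvb with h | h | h
    · exact hxv h
    · exact hcross _ hyA _ hb h
    · exact hcross _ hxA _ hb h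
  · have hyA : y ∉ A := fun h => hcross y h x ⟨hx, hxA⟩ (hsymm _ _ hxy)
    rcases hP x y v a hxy (hsymm _ _ hvy) hva with h | h | h
    · exact hxv h
    · exact hcross _ ha _ ⟨hy, hyA⟩ (hsymm _ _ h)
    · exact hcross _ ha _ ⟨hx, hxA⟩ (hsymm _ _ h)

/-- A finite set of at least two vertices of a graph without induced `P₄` has a disconnected
induced subgraph or co-subgraph. -/
lemma exists_split {V : Type*} {R : V → V → Prop} (hsymm : ∀ a b, R a b → R b a)
    (hP : ∀ a b c d, R a b → R b c → R c d → R a c ∨ R b d ∨ R a d)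
    {X : Set V} (hfin : X.Finite) (hX : X.Nontrivial) :
    ∃ C ⊆ X, C.Nonempty ∧ (X \ C).Nonempty ∧
      ((∀ a ∈ C, ∀ b ∈ X \ C, ¬ R a b) ∨ ∀ a ∈ C, ∀ b ∈ X \ C, R a b) := by
  induction X, hfin using Set.Finite.induction_on with
  | empty => exact absurd hX.nonempty (by simp)
  | @insert v X hv hfin ih =>
    by_cases hX' : X.Nontrivial
    · obtain ⟨A, hAX, hA, hB, h | h⟩ := ih hX'
      · exact exists_split_insert hsymm hP hv hAX hA hB h
      -- A complete cut is an empty cut of the complement, which is again `P₄`-free: a path a, b, c,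
      -- d there is the path c, a, d, b of `R`. The complement is reflexive wherever `R` is
      -- irreflexive, hence the use of bare symmetric relations.
      · obtain ⟨C, h1, h2, h3, h4⟩ := exists_split_insert (R := fun a b => ¬ R a b)
          (fun a b h h' => h (hsymm _ _ h')) (fun a b c d hab hbc hcd => by
            by_contra! hn
            rcases hP c a d b (hsymm _ _ hn.1) hn.2.2 (hsymm _ _ hn.2.1) with h | h | h
            · exact hcd h
            · exact hab h
            · exact hbc (hsymm _ _ h)) hv hAX hA hB (by simpa using h)
        refine ⟨C, h1, h2, h3, ?_⟩
        rw [or_comm]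
        simpa using h4
    · rw [Set.not_nontrivial_iff] at hX'
      have hne : X.Nonempty := by
        by_contra h
        rw [Set.not_nonempty_iff_eq_empty] at h
        subst h
        simp at hX
      obtain ⟨x, hx⟩ := hne
      have key : ∀ y ∈ insert v X \ {v}, y = x := by
        rintro y ⟨rfl | hy, hy'⟩
        · exact absurd rfl hy'
        · exact hX' hy hx
      refine ⟨{v}, by simp, by simp, ⟨x, Or.inr hx, by rintro rfl; exact hv hx⟩, ?_⟩
      by_cases h : R v x
      · right
        rintro a rfl b hb
        rw [key b hb]
        exact h
      · left
        rintro a rfl b hb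
        rw [key b hb]
        exact h

/-! ### Co-graphs -/

lemma IsCograph.isP₄Free {V : Type u} {G : SimpleGraph V} (hG : IsCograph G) : IsP₄Free G := by
  induction hG with
  | single => intro a b c d h; simp at h
  | @graphUnion k hk V G hG ih =>
    have hfst : ∀ p q, (OrientedCograph.graphUnion G).Adj p q → p.1 = q.1 := by
      rintro _ _ ⟨i, x, y, rfl, rfl, h⟩
      rfl
    have key : ∀ i (x y : V i), (OrientedCograph.graphUnion G).Adj ⟨i, x⟩ ⟨i, y⟩ ↔
        (G i).Adj x y := by
      intro i x y
      constructor
      · rintro ⟨_, _, _, ⟨⟩, ⟨⟩, h⟩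
        exact h
      · exact fun h => ⟨_, _, _, rfl, rfl, h⟩
    rintro ⟨i, a⟩ ⟨j, b⟩ ⟨l, c⟩ ⟨m, d⟩ hab hbc hcd
    obtain rfl : i = j := hfst _ _ hab
    obtain rfl : i = l := hfst _ _ hbc
    obtain rfl : i = m := hfst _ _ hcd
    simp only [key] at *
    exact ih i a b c d hab hbc hcd
  | @graphJoin k hk V G hG ih =>
    have key : ∀ i (x y : V i), (OrientedCograph.graphJoin G).Adj ⟨i, x⟩ ⟨i, y⟩ ↔ (G i).Adj x y := by
      intro i x y
      constructor
      · rintro (⟨_, _, _, ⟨⟩, ⟨⟩, h⟩ | h)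
        · exact h
        · exact absurd rfl h
      · exact fun h => Or.inl ⟨_, _, _, rfl, rfl, h⟩
    rintro ⟨i, a⟩ ⟨j, b⟩ ⟨l, c⟩ ⟨m, d⟩ hab hbc hcd
    by_contra! hn
    -- Non-adjacent vertices of a join share a part, and the three non-edges of a path connect its
    -- four vertices.
    have h1 : i = l := by by_contra h; exact hn.1 (Or.inr h)
    have h2 : j = m := by by_contra h; exact hn.2.1 (Or.inr h)
    have h3 : i = m := by by_contra h; exact hn.2.2 (Or.inr h)
    subst h1 h2 h3
    simp only [key] at hab hbc hcd hn
    have := ih i a b c d hab hbc hcd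
    tauto
  | @iso V W G H e hG ih =>
    intro a b c d
    have := ih (e.symm a) (e.symm b) (e.symm c) (e.symm d)
    simpa only [e.symm.map_adj_iff] using this

lemma isCograph_of_unique {V : Type u} [Unique V] (G : SimpleGraph V) : IsCograph G := by
  have : G = ⊥ := by
    ext a b
    simp [Subsingleton.elim a b]
  exact this ▸ .single

lemma isCograph_of_fibers_union {V : Type u} {k : ℕ} (hk : 1 ≤ k) {G : SimpleGraph V}
    (f : V → Fin k)
    (hf : ∀ i, IsCograph (G.comap (Subtype.val : {x // f x = i} → V)))
    (h : ∀ x y, G.Adj x y → f x = f y) : IsCograph G := by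
  refine .iso ⟨Equiv.sigmaFiberEquiv f, ?_⟩ (.graphUnion hk _ hf)
  rintro ⟨i, a, hi⟩ ⟨j, b, hj⟩
  constructor
  · intro hab
    obtain rfl : i = j := hi.symm.trans ((h a b hab).trans hj)
    exact ⟨i, _, _, rfl, rfl, hab⟩
  · rintro ⟨_, _, _, ⟨⟩, ⟨⟩, hab⟩
    exact hab

lemma isCograph_of_fibers_join {V : Type u} {k : ℕ} (hk : 1 ≤ k) {G : SimpleGraph V}
    (f : V → Fin k)
    (hf : ∀ i, IsCograph (G.comap (Subtype.val : {x // f x = i} → V)))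
    (h : ∀ x y, f x ≠ f y → G.Adj x y) : IsCograph G := by
  refine .iso ⟨Equiv.sigmaFiberEquiv f, ?_⟩ (.graphJoin hk _ hf)
  rintro ⟨i, a, hi⟩ ⟨j, b, hj⟩
  constructor
  · intro hab
    by_cases e : i = j
    · subst e
      exact Or.inl ⟨i, _, _, rfl, rfl, hab⟩
    · exact Or.inr e
  · rintro (⟨_, _, _, ⟨⟩, ⟨⟩, hab⟩ | hab)
    · exact hab
    · exact h a b (by rw [hi, hj]; exact hab)

/-- A nonempty set with nonempty complement is the zero fibre of a surjection onto `Fin 2`. -/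
lemma exists_indicator {V : Type*} {C : Set V} (hC : C.Nonempty) (hC' : (Set.univ \ C).Nonempty) :
    ∃ f : V → Fin 2, Function.Surjective f ∧ (∀ x, f x = 0 ↔ x ∈ C) ∧ ∀ x, f x = 1 ↔ x ∉ C := by
  classical
  refine ⟨fun x => if x ∈ C then 0 else 1, ?_, ?_, ?_⟩
  · intro i
    obtain ⟨a, ha⟩ := hC
    obtain ⟨b, hb⟩ := hC'
    fin_cases i
    · exact ⟨a, by simp [ha]⟩
    · exact ⟨b, by simp [hb.2]⟩
  · intro x; by_cases hx : x ∈ C <;> simp [hx]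
  · intro x; by_cases hx : x ∈ C <;> simp [hx]

lemma card_fiber_lt {V : Type*} [Finite V] {f : V → Fin 2} (hf : Function.Surjective f)
    (i : Fin 2) : Nat.card {x // f x = i} < Nat.card V := by
  obtain ⟨j, hj⟩ := exists_ne i
  obtain ⟨x, hx⟩ := hf j
  exact Finite.card_subtype_lt (x := x) (by rw [hx]; exact hj)

lemma IsP₄Free.isCograph {V : Type u} [Finite V] [Nonempty V] {G : SimpleGraph V}
    (hG : IsP₄Free G) : IsCograph G := by
  induction hn : Nat.card V using Nat.strong_induction_on generalizing V with
  | _ n ih =>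
  rcases subsingleton_or_nontrivial V with hs | hs
  · inhabit V
    have := Unique.mk' V
    exact isCograph_of_unique G
  obtain ⟨C, -, hC, hC', hsplit⟩ := exists_split (R := G.Adj) (fun _ _ => G.symm.symm _ _) hG
    Set.finite_univ (Set.nontrivial_univ_iff.2 hs)
  obtain ⟨f, hf, h0, h1⟩ := exists_indicator hC hC'
  have hfib : ∀ i, IsCograph (G.comap (Subtype.val : {x // f x = i} → V)) := by
    intro i
    obtain ⟨x, hx⟩ := hf i
    have : Nonempty {x // f x = i} := ⟨⟨x, hx⟩⟩
    exact ih _ (hn ▸ card_fiber_lt hf i) (G := G.comap _) (fun a b c d => hG a b c d) rfl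
  have hcases : ∀ x y, f x ≠ f y → x ∈ C ∧ y ∉ C ∨ y ∈ C ∧ x ∉ C := by
    intro x y hxy
    simp only [← h0]
    omega
  rcases hsplit with h | h
  · refine isCograph_of_fibers_union (by norm_num) f hfib fun x y hxy => ?_
    by_contra hne
    rcases hcases x y hne with ⟨hx, hy⟩ | ⟨hx, hy⟩
    · exact h x hx y ⟨trivial, hy⟩ hxy
    · exact h y hx x ⟨trivial, hy⟩ hxy.symm
  · refine isCograph_of_fibers_join (by norm_num) f hfib fun x y hne => ?_
    rcases hcases x y hne with ⟨hx, hy⟩ | ⟨hx, hy⟩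
    · exact h x hx y ⟨trivial, hy⟩
    · exact (h y hx x ⟨trivial, hy⟩).symm

/-! ### Decomposition of series-parallel digraphs -/

lemma un_adj_iff {V : Type u} {G : Digraph V} (hloop : ∀ v, ¬ G.Adj v v) (a b : V) :
    (un G).Adj a b ↔ G.Adj a b ∨ G.Adj b a := by
  change a ≠ b ∧ _ ↔ _
  refine ⟨And.right, fun h => ⟨?_, h⟩⟩
  rintro rfl
  exact hloop a (h.elim id id)

/-- Two consecutive arcs of a path that point the same way give a chord by transitivity; an
alternating path is an N, read from one end or the other. -/
lemma IsSeriesParallel.isP₄Free_un {V : Type u} {G : Digraph V} (hG : IsSeriesParallel G) :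
    IsP₄Free (un G) := by
  intro a b c d
  simp only [un_adj_iff hG.irrefl]
  rintro (ab | ba) (bc | cb) (cd | dc)
  · exact Or.inl (Or.inl (hG.trans _ _ _ ab bc))
  · exact Or.inl (Or.inl (hG.trans _ _ _ ab bc))
  · have := hG.nFree a b c d ab cb cd
    tauto
  · exact Or.inr (Or.inl (Or.inr (hG.trans _ _ _ dc cb)))
  · exact Or.inr (Or.inl (Or.inl (hG.trans _ _ _ bc cd)))
  · have := hG.nFree d c b a dc bc ba
    tauto
  · exact Or.inl (Or.inr (hG.trans _ _ _ cb ba))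
  · exact Or.inl (Or.inr (hG.trans _ _ _ cb ba))

/-- A vertex set that is comparable to its complement yields a decomposition of a strict order as
an ordinal sum. -/
lemma exists_ordinal_split {V : Type*} [Finite V] {R : V → V → Prop}
    (htrans : ∀ a b c, R a b → R b c → R a c) {C₀ : Set V} (hne : C₀.Nonempty)
    (hne' : (Set.univ \ C₀).Nonempty) (hcomp : ∀ a ∈ C₀, ∀ b ∉ C₀, R a b ∨ R b a) :
    ∃ L : Set V, L.Nonempty ∧ (Set.univ \ L).Nonempty ∧ ∀ a ∈ L, ∀ b ∉ L, R a b := by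
  -- Minimality makes every outside vertex x lie above all of C or below all of C: the members of C
  -- below x, if there are any, again form a set comparable to its complement.
  obtain ⟨C, hC₀, ⟨hC, hCcomp⟩, hmin⟩ := exists_minimal_le_of_wellFoundedLT
    (fun C : Set V => C.Nonempty ∧ ∀ a ∈ C, ∀ b ∉ C, R a b ∨ R b a) C₀ ⟨hne, hcomp⟩
  have hC' : (Set.univ \ C).Nonempty := hne'.mono (Set.sdiff_subset_sdiff_right hC₀)
  have hunif : ∀ x ∉ C, (∀ y ∈ C, R y x) ∨ ∀ y ∈ C, R x y := by
    intro x hx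
    by_cases h : ∃ y ∈ C, R y x
    · obtain ⟨y, hy, hyx⟩ := h
      left
      have := hmin (y := {y ∈ C | R y x}) ⟨⟨y, hy, hyx⟩, ?_⟩ (fun z hz => hz.1)
      · exact fun z hz => (this hz).2
      · rintro a ⟨ha, hax⟩ b hb
        by_cases hbC : b ∈ C
        · rcases hCcomp b hbC x hx with h | h
          · exact absurd ⟨hbC, h⟩ hb
          · exact Or.inl (htrans _ _ _ hax h)
        · exact hCcomp a ha b hbC
    · right
      intro y hy
      exact (hCcomp y hy x hx).resolve_left fun h' => h ⟨y, hy, h'⟩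
  -- The lower part consists of the vertices below C, or is C itself if there are none.
  by_cases hL : ∃ x ∉ C, ∀ y ∈ C, R x y
  · obtain ⟨c, hc⟩ := hC
    refine ⟨{x | x ∉ C ∧ ∀ y ∈ C, R x y}, hL, ⟨c, trivial, fun h => h.1 hc⟩, ?_⟩
    rintro a ⟨ha, ha'⟩ b hb
    by_cases hbC : b ∈ C
    · exact ha' b hbC
    · rcases hunif b hbC with h | h
      · exact htrans _ _ _ (ha' c hc) (h c hc)
      · exact absurd ⟨hbC, h⟩ hb
  · exact ⟨C, hC, hC', fun a ha b hb => (hunif b hb).resolve_right (fun h => hL ⟨b, hb, h⟩) a ha⟩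

/-- Both fibres of a split are nonempty and strictly smaller, so strong induction on the number of
vertices applies to each. -/
theorem IsSeriesParallel.induction {motive : ∀ {V : Type u}, Digraph V → Prop}
    (single : ∀ {V : Type u} [Unique V], motive (⊥ : Digraph V))
    (union : ∀ {V : Type u} (G : Digraph V) (f : V → Fin 2),
      (∀ i, motive (fiberDigraph G f i)) → (∀ x y, G.Adj x y → f x = f y) → motive G)
    (order : ∀ {V : Type u} (G : Digraph V) (f : V → Fin 2),
      (∀ i, motive (fiberDigraph G f i)) → (∀ x y, f x < f y → G.Adj x y) →
      (∀ x y, G.Adj x y → f x ≤ f y) → motive G)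
    {V : Type u} [Finite V] [Nonempty V] {G : Digraph V} (hG : IsSeriesParallel G) :
    motive G := by
  induction hn : Nat.card V using Nat.strong_induction_on generalizing V with
  | _ n ih =>
  rcases subsingleton_or_nontrivial V with hs | hs
  · inhabit V
    have := Unique.mk' V
    have hbot : G = ⊥ := by
      ext a b
      rw [Subsingleton.elim a b]
      exact iff_of_false (hG.irrefl b) id
    exact hbot ▸ single
  have hfib : ∀ f : V → Fin 2, Function.Surjective f → ∀ i, motive (fiberDigraph G f i) := by
    intro f hf i
    obtain ⟨x, hx⟩ := hf i
    have : Nonempty {x // f x = i} := ⟨⟨x, hx⟩⟩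
    exact ih _ (hn ▸ card_fiber_lt hf i) (hG.of_comap Subtype.val fun _ _ => Iff.rfl) rfl
  obtain ⟨C, -, hC, hC', hsplit⟩ := exists_split (R := (un G).Adj)
    (fun _ _ => (un G).symm.symm _ _) hG.isP₄Free_un
    Set.finite_univ (Set.nontrivial_univ_iff.2 hs)
  simp only [un_adj_iff hG.irrefl] at hsplit
  rcases hsplit with h | h
  · obtain ⟨f, hf, h0, -⟩ := exists_indicator hC hC'
    refine union G f (hfib f hf) fun x y hxy => ?_
    by_cases hx : x ∈ C <;> by_cases hy : y ∈ C
    · rw [(h0 x).2 hx, (h0 y).2 hy]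
    · exact absurd (Or.inl hxy) (h x hx y ⟨trivial, hy⟩)
    · exact absurd (Or.inr hxy) (h y hy x ⟨trivial, hx⟩)
    · rw [← h0] at hx hy
      omega
  · obtain ⟨L, hL, hL', hLR⟩ := exists_ordinal_split hG.trans hC hC'
      fun a ha b hb => h a ha b ⟨trivial, hb⟩
    obtain ⟨f, hf, h0, h1⟩ := exists_indicator hL hL'
    have hlt : ∀ x y, f x < f y → G.Adj x y := fun x y hxy =>
      hLR x ((h0 x).1 (by omega)) y ((h1 y).1 (by omega))
    exact order G f (hfib f hf) hlt fun x y hxy =>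
      not_lt.1 fun hyx => hG.asymm _ _ hxy (hlt _ _ hyx)

/-! ### Oriented co-graphs -/

lemma disjointUnion_adj_iff {k : ℕ} {V : Fin k → Type u} {G : ∀ i, Digraph (V i)} {i : Fin k}
    {x y : V i} : (disjointUnion G).Adj ⟨i, x⟩ ⟨i, y⟩ ↔ (G i).Adj x y := by
  constructor
  · rintro ⟨_, _, _, ⟨⟩, ⟨⟩, h⟩
    exact h
  · exact fun h => ⟨_, _, _, rfl, rfl, h⟩

lemma fst_eq_of_disjointUnion_adj {k : ℕ} {V : Fin k → Type u} {G : ∀ i, Digraph (V i)}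
    {p q : Σ i, V i} (h : (disjointUnion G).Adj p q) : p.1 = q.1 := by
  obtain ⟨i, x, y, rfl, rfl, h⟩ := h
  rfl

lemma orderComp_adj_iff {k : ℕ} {V : Fin k → Type u} {G : ∀ i, Digraph (V i)} {i : Fin k}
    {x y : V i} : (orderComp G).Adj ⟨i, x⟩ ⟨i, y⟩ ↔ (G i).Adj x y := by
  rw [← disjointUnion_adj_iff (G := G)]
  exact or_iff_left (lt_irrefl i)

lemma isSeriesParallel_fiber_fst {k : ℕ} {V : Fin k → Type u} {G : ∀ i, Digraph (V i)}
    {H : Digraph (Σ i, V i)} (h : ∀ i (x y : V i), H.Adj ⟨i, x⟩ ⟨i, y⟩ ↔ (G i).Adj x y)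
    (hG : ∀ i, IsSeriesParallel (G i)) (i : Fin k) :
    IsSeriesParallel (fiberDigraph H Sigma.fst i) := by
  refine (hG i).of_comap (fun p => p.2 ▸ p.1.2) ?_
  rintro ⟨⟨j, x⟩, hj⟩ ⟨⟨l, y⟩, hl⟩
  obtain rfl : j = i := hj
  obtain rfl : l = j := hl
  exact h _ _ _

lemma isSeriesParallel_bot {V : Type u} : IsSeriesParallel (⊥ : Digraph V) :=
  ⟨fun _ => id, fun _ _ _ => False.elim, fun _ _ _ _ => False.elim⟩

lemma IsOrientedCograph.isSeriesParallel {V : Type u} {G : Digraph V}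
    (hG : IsOrientedCograph G) : IsSeriesParallel G := by
  induction hG with
  | single => exact isSeriesParallel_bot
  | disjointUnion hk G hG ih =>
    exact .of_fibers Sigma.fst (isSeriesParallel_fiber_fst (fun _ _ _ => disjointUnion_adj_iff) ih)
      (Or.inl fun _ _ => fst_eq_of_disjointUnion_adj)
  | orderComp hk G hG ih =>
    refine .of_fibers Sigma.fst (isSeriesParallel_fiber_fst (fun _ _ _ => orderComp_adj_iff) ih)
      (Or.inr ⟨fun _ _ => Or.inr, ?_⟩)
    rintro x y (h | h)
    · exact (fst_eq_of_disjointUnion_adj h).le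
    · exact h.le
  | iso e hG ih => exact ih.of_comap e.symm fun _ _ => e.symm.map_rel_iff.symm

lemma IsSeriesParallel.isOrientedCograph {V : Type u} [Finite V] [Nonempty V] {G : Digraph V}
    (hG : IsSeriesParallel G) : IsOrientedCograph G := by
  refine hG.induction (motive := fun G => IsOrientedCograph G) .single ?_ ?_
  · intro V G f hf h
    refine .iso ⟨Equiv.sigmaFiberEquiv f, ?_⟩ (.disjointUnion (by norm_num) _ hf)
    rintro ⟨i, a, hi⟩ ⟨j, b, hj⟩
    constructor
    · intro hab
      obtain rfl : i = j := hi.symm.trans ((h a b hab).trans hj)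
      exact disjointUnion_adj_iff.2 hab
    · intro hab
      obtain rfl : i = j := fst_eq_of_disjointUnion_adj hab
      exact disjointUnion_adj_iff.1 hab
  · intro V G f hf h1 h2
    refine .iso ⟨Equiv.sigmaFiberEquiv f, ?_⟩ (.orderComp (by norm_num) _ hf)
    rintro ⟨i, a, hi⟩ ⟨j, b, hj⟩
    constructor
    · intro hab
      rcases (h2 a b hab).lt_or_eq with h | h
      · exact Or.inr (hi ▸ hj ▸ h)
      · obtain rfl : i = j := hi.symm.trans (h.trans hj)
        exact orderComp_adj_iff.2 hab
    · intro hab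
      by_cases hij : i = j
      · subst hij
        exact orderComp_adj_iff.1 hab
      · rcases hab with h | h
        · exact absurd (fst_eq_of_disjointUnion_adj h) hij
        · exact h1 a b (by rw [hi, hj]; exact h)

/-! ### Directed NLC-width and directed clique-width -/

lemma IsSeriesParallel.of_sum {V W : Type u} {G : Digraph (V ⊕ W)} {H : Digraph V}
    {J : Digraph W} (hH : IsSeriesParallel H) (hJ : IsSeriesParallel J)
    (hl : ∀ x y, G.Adj (.inl x) (.inl y) ↔ H.Adj x y)
    (hr : ∀ x y, G.Adj (.inr x) (.inr y) ↔ J.Adj x y)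
    (h : (∀ x y, ¬ G.Adj (.inl x) (.inr y) ∧ ¬ G.Adj (.inr y) (.inl x)) ∨
      (∀ x y, G.Adj (.inl x) (.inr y) ∧ ¬ G.Adj (.inr y) (.inl x)) ∨
      ∀ x y, ¬ G.Adj (.inl x) (.inr y) ∧ G.Adj (.inr y) (.inl x)) : IsSeriesParallel G := by
  -- Both maps to `Bool` are needed: `Sum.isRight` puts the left summand below, `Sum.isLeft` puts it
  -- above.
  have hL : ∀ f : V ⊕ W → Bool, (f = Sum.isLeft ∨ f = Sum.isRight) → ∀ i,
      IsSeriesParallel (fiberDigraph G f i) := by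
    intro f hf i
    have hside : (∀ p, f p = i → p.isLeft) ∨ ∀ p, f p = i → p.isRight := by
      rcases hf with rfl | rfl <;> cases i <;> simp
    rcases hside with hs | hs
    · refine hH.of_comap (fun p => p.1.getLeft (hs _ p.2)) ?_
      rintro ⟨x | x, hx⟩ ⟨y | y, hy⟩
      · exact hl x y
      · exact absurd (hs _ hy) (by simp)
      · exact absurd (hs _ hx) (by simp)
      · exact absurd (hs _ hx) (by simp)
    · refine hJ.of_comap (fun p => p.1.getRight (hs _ p.2)) ?_
      rintro ⟨x | x, hx⟩ ⟨y | y, hy⟩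
      · exact absurd (hs _ hx) (by simp)
      · exact absurd (hs _ hx) (by simp)
      · exact absurd (hs _ hy) (by simp)
      · exact hr x y
  rcases h with h | h | h
  · refine .of_fibers Sum.isRight (hL _ (Or.inr rfl)) (Or.inl ?_)
    rintro (x | x) (y | y) <;> simp [h]
  · refine .of_fibers Sum.isRight (hL _ (Or.inr rfl)) (Or.inr ⟨?_, ?_⟩) <;>
      rintro (x | x) (y | y) <;> simp [h]
  · refine .of_fibers Sum.isLeft (hL _ (Or.inl rfl)) (Or.inr ⟨?_, ?_⟩) <;>
      rintro (x | x) (y | y) <;> simp [h]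

lemma DNLC.isSeriesParallel {V : Type u} {G : Digraph V} {lab : V → Fin 1} (hG : DNLC 1 G lab)
    (hasymm : ∀ a b, G.Adj a b → ¬ G.Adj b a) : IsSeriesParallel G := by
  induction hG with
  | single => exact isSeriesParallel_bot
  | @comp V W G labG H labH hG hH S T ihG ihH =>
    refine .of_sum (ihG fun a b => hasymm (.inl a) (.inl b))
      (ihH fun a b => hasymm (.inr a) (.inr b)) (fun _ _ => Iff.rfl) (fun _ _ => Iff.rfl) ?_
    -- With a single label, each of `S` and `T` inserts all cross arcs of its direction or none.
    have hlr : ∀ x y, (nlcComp G labG H labH S T).Adj (.inl x) (.inr y) ↔ (0, 0) ∈ S := by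
      intro x y
      rw [← Subsingleton.elim (labG x) 0]
      nth_rw 2 [← Subsingleton.elim (labH y) (labG x)]
      rfl
    have hrl : ∀ x y, (nlcComp G labG H labH S T).Adj (.inr y) (.inl x) ↔ (0, 0) ∈ T := by
      intro x y
      rw [← Subsingleton.elim (labG x) 0]
      nth_rw 2 [← Subsingleton.elim (labH y) (labG x)]
      rfl
    have := fun x y => hasymm (.inl x) (.inr y)
    simp only [hlr, hrl] at this ⊢
    by_cases hS : ((0, 0) : Fin 1 × Fin 1) ∈ S <;> by_cases hT : ((0, 0) : Fin 1 × Fin 1) ∈ T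
    -- If both directions were inserted, asymmetry would leave no cross pair, so the alternative
    -- holds vacuously.
    · exact Or.inl fun x y => absurd hT (this x y hS)
    all_goals simp [hS, hT]
  | relabel hG R ih => exact ih hasymm
  | iso e hG ih =>
    refine (ih fun a b => ?_).of_comap e.symm fun _ _ => e.symm.map_rel_iff.symm
    rw [← e.map_rel_iff, ← e.map_rel_iff]
    exact hasymm _ _

lemma sum_adj_inl_iff {V W : Type u} {G : Digraph V} {H : Digraph W} {x y : V} :
    (sum G H).Adj (.inl x) (.inl y) ↔ G.Adj x y :=
  Sum.liftRel_inl_inl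

lemma sum_adj_inr_iff {V W : Type u} {G : Digraph V} {H : Digraph W} {x y : W} :
    (sum G H).Adj (.inr x) (.inr y) ↔ H.Adj x y :=
  Sum.liftRel_inr_inr

lemma DCW.isSeriesParallel {k : ℕ} (hk : k ≤ 2) {V : Type u} {G : Digraph V} {lab : V → Fin k}
    (hG : DCW k G lab) (hasymm : ∀ a b, G.Adj a b → ¬ G.Adj b a) : IsSeriesParallel G := by
  induction hG with
  | single => exact isSeriesParallel_bot
  | @union V W G labG H labH hG hH ihG ihH =>
    refine .of_sum (ihG fun a b hab hba => hasymm (.inl a) (.inl b) (.inl hab) (.inl hba))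
      (ihH fun a b hab hba => hasymm (.inr a) (.inr b) (.inr hab) (.inr hba))
      (fun _ _ => sum_adj_inl_iff) (fun _ _ => sum_adj_inr_iff)
      (Or.inl fun x y => ⟨Sum.not_liftRel_inl_inr, Sum.not_liftRel_inr_inl⟩)
  | relabel hG a b ih => exact ih hasymm
  | @addArcs V G lab hG a b hab ih =>
    have hSP := ih fun x y hxy hyx => hasymm x y (Or.inl hxy) (Or.inl hyx)
    -- With at most two labels, a label other than b is a. All arcs then run from the rest to the
    -- vertices labelled b, asymmetry forbids arcs back, and neither fibre gains an arc: the result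
    -- is an ordinal sum.
    have hlt : ∀ x y, decide (lab x = b) < decide (lab y = b) →
        (OrientedCograph.addArcs G lab a b).Adj x y := by
      intro x y hxy
      simp only [Bool.lt_iff, decide_eq_false_iff_not, decide_eq_true_eq] at hxy
      exact Or.inr ⟨by omega, hxy.2⟩
    refine .of_fibers (fun v => decide (lab v = b)) (fun i => ?_) (Or.inr ⟨hlt, fun x y hxy =>
      not_lt.1 fun hyx => hasymm _ _ hxy (hlt _ _ hyx)⟩)
    refine hSP.of_comap Subtype.val ?_
    rintro ⟨x, hx⟩ ⟨y, hy⟩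
    refine or_iff_left ?_
    rintro ⟨hxa, hyb⟩
    have hxb : lab x = b := by simpa [hyb] using hx.trans hy.symm
    exact hab (hxa.symm.trans hxb)
  | iso e hG ih =>
    refine (ih fun a b => ?_).of_comap e.symm fun _ _ => e.symm.map_rel_iff.symm
    rw [← e.map_rel_iff, ← e.map_rel_iff]
    exact hasymm _ _

/-! ### Constructions with one NLC label and two clique-width labels -/

/-- A type is the sum of the fibres of a map to `Fin 2`. -/
noncomputable def sumFiberEquiv {V : Type*} (f : V → Fin 2) :
    {x // f x = 0} ⊕ {x // f x = 1} ≃ V :=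
  Equiv.ofBijective (Sum.elim Subtype.val Subtype.val) (by
    constructor
    · rintro (⟨x, hx⟩ | ⟨x, hx⟩) (⟨y, hy⟩ | ⟨y, hy⟩) h <;> obtain rfl : x = y := h
      · rfl
      · simp [hx] at hy
      · simp [hx] at hy
      · rfl
    · intro x
      by_cases h : f x = 0
      · exact ⟨.inl ⟨x, h⟩, rfl⟩
      · exact ⟨.inr ⟨x, by omega⟩, rfl⟩)

lemma IsSeriesParallel.exists_DNLC {V : Type u} [Finite V] [Nonempty V] {G : Digraph V}
    (hG : IsSeriesParallel G) : ∃ lab : V → Fin 1, DNLC 1 G lab := by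
  refine hG.induction (motive := fun {V} G => ∃ lab : V → Fin 1, DNLC 1 G lab)
    ⟨_, .single 0⟩ ?_ ?_
  · intro V G f hf h
    obtain ⟨l0, h0⟩ := hf 0
    obtain ⟨l1, h1⟩ := hf 1
    refine ⟨_, .iso ⟨sumFiberEquiv f, ?_⟩ (.comp h0 h1 ∅ ∅)⟩
    rintro (⟨x, hx⟩ | ⟨x, hx⟩) (⟨y, hy⟩ | ⟨y, hy⟩)
    · exact Iff.rfl
    · exact iff_of_false (fun hxy => by simpa [hx, hy] using h x y hxy) id
    · exact iff_of_false (fun hxy => by simpa [hx, hy] using h x y hxy) id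
    · exact Iff.rfl
  · intro V G f hf hlt hle
    obtain ⟨l0, h0⟩ := hf 0
    obtain ⟨l1, h1⟩ := hf 1
    refine ⟨_, .iso ⟨sumFiberEquiv f, ?_⟩ (.comp h0 h1 Set.univ ∅)⟩
    rintro (⟨x, hx⟩ | ⟨x, hx⟩) (⟨y, hy⟩ | ⟨y, hy⟩)
    · exact Iff.rfl
    · exact iff_of_true (hlt x y (by simp [hx, hy])) trivial
    · exact iff_of_false (fun hxy => by simpa [hx, hy] using hle x y hxy) id
    · exact Iff.rfl

/-- The constant labelling is what lets the recursion run: for an ordinal sum the upper part is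
relabelled 1, arcs are inserted from 0 to 1, and label 1 is merged back into 0. -/
lemma IsSeriesParallel.DCW_two {V : Type u} [Finite V] [Nonempty V] {G : Digraph V}
    (hG : IsSeriesParallel G) : DCW 2 G (fun _ => 0) := by
  refine hG.induction (motive := fun {V} G => DCW 2 G (fun _ => 0)) (.single 0) ?_ ?_
  · intro V G f hf h
    let e : (sum (fiberDigraph G f 0) (fiberDigraph G f 1)).Adj ≃r G.Adj := by
      refine ⟨sumFiberEquiv f, ?_⟩
      rintro (⟨x, hx⟩ | ⟨x, hx⟩) (⟨y, hy⟩ | ⟨y, hy⟩)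
      · exact (sum_adj_inl_iff (G := fiberDigraph G f 0) (H := fiberDigraph G f 1) (x := ⟨x, hx⟩)
          (y := ⟨y, hy⟩)).symm
      · exact iff_of_false (fun hxy => by simpa [hx, hy] using h x y hxy) Sum.not_liftRel_inl_inr
      · exact iff_of_false (fun hxy => by simpa [hx, hy] using h x y hxy) Sum.not_liftRel_inr_inl
      · exact (sum_adj_inr_iff (G := fiberDigraph G f 0) (H := fiberDigraph G f 1) (x := ⟨x, hx⟩)
          (y := ⟨y, hy⟩)).symm
    convert DCW.iso e (.union (hf 0) (hf 1)) using 2 with v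
    cases e.symm v <;> rfl
  · intro V G f hf hlt hle
    have h1 := DCW.relabel (hf 1) 0 1
    simp only [if_true] at h1
    have h2 := DCW.addArcs (.union (hf 0) h1) zero_ne_one
    let e : (addArcs (sum (fiberDigraph G f 0) (fiberDigraph G f 1))
        (Sum.elim (fun _ => (0 : Fin 2)) (fun _ => 1)) 0 1).Adj ≃r G.Adj := by
      refine ⟨sumFiberEquiv f, ?_⟩
      rintro (⟨x, hx⟩ | ⟨x, hx⟩) (⟨y, hy⟩ | ⟨y, hy⟩)
      · refine Iff.trans (sum_adj_inl_iff (G := fiberDigraph G f 0) (H := fiberDigraph G f 1) (x := ⟨x, hx⟩)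
          (y := ⟨y, hy⟩)).symm
          (Iff.symm (or_iff_left ?_))
        simp
      · exact iff_of_true (hlt x y (by simp [hx, hy])) (Or.inr ⟨rfl, rfl⟩)
      · refine iff_of_false (fun hxy => by simpa [hx, hy] using hle x y hxy) ?_
        rintro (h | h)
        · exact Sum.not_liftRel_inr_inl h
        · simp at h
      · refine Iff.trans (sum_adj_inr_iff (G := fiberDigraph G f 0) (H := fiberDigraph G f 1) (x := ⟨x, hx⟩)
          (y := ⟨y, hy⟩)).symm
          (Iff.symm (or_iff_left ?_))
        simp
    convert DCW.iso e (.relabel h2 1 0) using 2 with v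
    cases e.symm v <;> rfl

lemma iInf_nat_le_iff {P : ℕ → Prop} {n : ℕ} :
    (⨅ (k : ℕ) (_ : P k), (k : ℕ∞)) ≤ n ↔ ∃ k ≤ n, P k := by
  constructor
  · intro h
    by_contra! hn
    have : ((n + 1 : ℕ) : ℕ∞) ≤ ⨅ (k : ℕ) (_ : P k), (k : ℕ∞) :=
      le_iInf₂ fun k hk => Nat.cast_le.2 (by by_contra hlt; exact hn k (by omega) hk)
    have := Nat.cast_le.1 (this.trans h)
    omega
  · rintro ⟨k, hk, hP⟩
    exact (iInf₂_le k hP).trans (Nat.cast_le.2 hk)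

/-- Width 0 is impossible because a nonempty vertex set has no labelling in `Fin 0`. -/
lemma dNLCWidth_eq_one_iff {V : Type u} [Nonempty V] {G : Digraph V} :
    dNLCWidth G = 1 ↔ ∃ lab : V → Fin 1, DNLC 1 G lab := by
  have h0 : ¬ dNLCWidth G ≤ (0 : ℕ) := by
    rw [dNLCWidth, iInf_nat_le_iff]
    rintro ⟨k, hk, lab, -⟩
    have := (lab (Classical.arbitrary V)).pos
    omega
  have h1 : dNLCWidth G ≤ (1 : ℕ) ↔ ∃ lab : V → Fin 1, DNLC 1 G lab := by
    rw [dNLCWidth, iInf_nat_le_iff]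
    refine ⟨?_, fun h => ⟨1, le_rfl, h⟩⟩
    rintro ⟨k, hk, lab, h⟩
    obtain rfl : k = 1 := by
      have := (lab (Classical.arbitrary V)).pos
      omega
    exact ⟨lab, h⟩
  rw [← h1]
  constructor
  · exact fun h => h.le
  · intro h
    refine le_antisymm h (Order.one_le_iff_pos.2 (pos_iff_ne_zero.2 fun h' => h0 (by simp [h'])))

end OrientedCograph

/-! ### The seven equivalences -/

open OrientedCograph in
theorem mainTheorem5 {V : Type u} [Finite V] [Nonempty V] (G : Digraph V)
    (hloop : ∀ v : V, ¬ G.Adj v v) :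
    List.TFAE [
      IsOrientedCograph G,
      Free {D₁, D₅, D₈, biP₂} G,
      Free {D₁, D₅, biP₂} G ∧ ¬ (SimpleGraph.pathGraph 4).IsIndContained (un G),
      Free {D₁, D₅, biP₂} G ∧ IsCograph (un G),
      dNLCWidth G = 1 ∧ Free {biP₂} G,
      dCliqueWidth G ≤ 2 ∧ Free {biP₂} G,
      IsTransitive G ∧ Free {biP₂, D₈} G] := by
  have hbi := isEmpty_embedding_biP₂_iff hloop
  have hord : Free {D₁, D₅, biP₂} G ↔ ∀ a b c, G.Adj a b → G.Adj b c → G.Adj a c := by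
    simp only [free_iff_embedding, Set.mem_insert_iff, Set.mem_singleton_iff, forall_eq_or_imp,
      forall_eq]
    constructor
    · rintro ⟨h1, h5, h2⟩ a b c hab hbc
      have hasymm := hbi.1 h2
      exact ((isEmpty_embedding_D₁_iff hloop hasymm).1 h1 a b c hab hbc).resolve_right
        ((isEmpty_embedding_D₅_iff hloop hasymm).1 h5 a b c hab hbc)
    · intro h
      have hasymm : ∀ a b, G.Adj a b → ¬ G.Adj b a := fun a b hab hba => hloop _ (h _ _ _ hab hba)
      exact ⟨(isEmpty_embedding_D₁_iff hloop hasymm).2 fun a b c hab hbc => Or.inl (h _ _ _ hab hbc),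
        (isEmpty_embedding_D₅_iff hloop hasymm).2 fun a b c hab hbc => hasymm _ _ (h _ _ _ hab hbc),
        hbi.2 hasymm⟩
  have hfree : Free {biP₂} G ↔ ∀ a b, G.Adj a b → ¬ G.Adj b a := by
    simpa [free_iff_embedding] using hbi
  have hcograph : IsCograph (un G) ↔ ¬ (SimpleGraph.pathGraph 4).IsIndContained (un G) := by
    rw [← isP₄Free_iff]
    exact ⟨fun h => h.isP₄Free, fun h => h.isCograph⟩
  have e1 : IsOrientedCograph G ↔ IsSeriesParallel G :=
    ⟨fun h => h.isSeriesParallel, fun h => h.isOrientedCograph⟩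
  have e2 : Free {D₁, D₅, D₈, biP₂} G ↔ IsSeriesParallel G := by
    have : Free {D₁, D₅, D₈, biP₂} G ↔ Free {D₁, D₅, biP₂} G ∧ IsEmpty (D₈.2.Adj ↪r G.Adj) := by
      simp only [free_iff_embedding, Set.mem_insert_iff, Set.mem_singleton_iff, forall_eq_or_imp,
        forall_eq]
      tauto
    rw [this, hord]
    constructor
    · exact fun ⟨h, h8⟩ => ⟨hloop, h, (isEmpty_embedding_D₈_iff hloop h).1 h8⟩
    · exact fun h => ⟨h.trans, (isEmpty_embedding_D₈_iff hloop h.trans).2 h.nFree⟩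
  have e3 : Free {D₁, D₅, biP₂} G ∧ ¬ (SimpleGraph.pathGraph 4).IsIndContained (un G) ↔
      IsSeriesParallel G := by
    rw [hord, ← isP₄Free_iff]
    refine ⟨fun ⟨h, hP⟩ => ⟨hloop, h, fun a b c d hab hcb hcd => ?_⟩,
      fun h => ⟨h.trans, h.isP₄Free_un⟩⟩
    have := hP a b c d
    simp only [un_adj_iff hloop] at this
    -- `P₄`-freeness also permits d → a, which is absent from `nFree`; transitivity turns it into c
    -- → a.
    have := h c d a hcd
    tauto
  have e4 : Free {D₁, D₅, biP₂} G ∧ IsCograph (un G) ↔ IsSeriesParallel G := by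
    rw [hcograph, e3]
  have e5 : dNLCWidth G = 1 ∧ Free {biP₂} G ↔ IsSeriesParallel G := by
    rw [dNLCWidth_eq_one_iff, hfree]
    exact ⟨fun ⟨⟨_, h⟩, h'⟩ => h.isSeriesParallel h', fun h => ⟨h.exists_DNLC, h.asymm⟩⟩
  have e6 : dCliqueWidth G ≤ 2 ∧ Free {biP₂} G ↔ IsSeriesParallel G := by
    have : dCliqueWidth G ≤ 2 ↔ ∃ k ≤ 2, ∃ lab : V → Fin k, DCW k G lab := iInf_nat_le_iff
    rw [this, hfree]
    exact ⟨fun ⟨⟨_, hk, _, h⟩, h'⟩ => h.isSeriesParallel hk h',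
      fun h => ⟨⟨2, le_rfl, _, h.DCW_two⟩, h.asymm⟩⟩
  have e7 : IsTransitive G ∧ Free {biP₂, D₈} G ↔ IsSeriesParallel G := by
    have : Free {biP₂, D₈} G ↔ (∀ a b, G.Adj a b → ¬ G.Adj b a) ∧ IsEmpty (D₈.2.Adj ↪r G.Adj) := by
      simp [free_iff_embedding, hbi]
    rw [this]
    constructor
    · rintro ⟨ht, hasymm, h8⟩
      -- The case of equal endpoints, exempt in `IsTransitive`, is a bidirected edge and cannot
      -- occur.
      have htrans : ∀ a b c, G.Adj a b → G.Adj b c → G.Adj a c := fun a b c hab hbc =>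
        ht a b c hab hbc (by rintro rfl; exact hasymm _ _ hab hbc)
      exact ⟨hloop, htrans, (isEmpty_embedding_D₈_iff hloop htrans).1 h8⟩
    · exact fun h => ⟨fun a b c hab hbc _ => h.trans _ _ _ hab hbc, h.asymm,
        (isEmpty_embedding_D₈_iff hloop h.trans).2 h.nFree⟩
  rw [e1, e2, e3, e4, e5, e6, e7]
  intro x hx y hy
  have hx' : x ↔ IsSeriesParallel G := by simpa using hx
  have hy' : y ↔ IsSeriesParallel G := by simpa using hy
  exact hx'.trans hy'.symm
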